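/- Let $\tfrac12\le\alpha\le 1$. Consider the attachment and grafting model with maximal degree $D=3$. This is a Markov chain on finite planar rooted trees whose root has degree one. Call an edge a \emph{leaf} if it is incident to a vertex of degree one other than the root, and an \emph{inner edge} otherwise. With $\eta=-\frac{1-\alpha}{D-2}=\alpha-1$, start from the unique such tree with two edges; in each step select, with probability proportional to the stated weights, either a vertex of degree $k\ge 2$, with weight $\eta k+1-2\eta-\alpha$, and attach a new edge to it (in one of the $k$ possible positions, chosen uniformly), or an inner edge, with weight $\alpha$, or a leaf, with weight $1-\eta$; a selected edge (inner edge or leaf) is divided into two edges by a new vertex. (Vertices of degree $3$ have weight $0$, so all degrees stay at most $3$.) Let $\nu_n$ be the law of the resulting tree with $n$ edges. Then $\nu_n$ converges weakly as $n\to\infty$, with respect to local convergence of trees, to a probability measure $\nu$ under which the tree almost surely has exactly one infinite non-backtracking path $r,s_1,s_2,\dots$ starting at the root $r$ (the spine). For $i\ge1$ let $\mathcal A^i$ (the outgrowth at $s_i$) consist of $s_i$ and all descendants of $s_i$ that are neither equal to $s_{i+1}$ nor descendants of $s_{i+1}$, and let $X^i_n$ be the number of vertices of $\mathcal A^i$ at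 distance $n$ from $s_i$. Then there is a sequence $\varepsilon_n\to0$ such that for all $i\ge1$ and $n\ge1$ $$\nu\big(X^i_n>0\big)\le\frac{2}{n}\,(1+\varepsilon_n).$$ -/

import Mathlib

open Filter Topology MeasureTheory

noncomputable section

namespace AGModel

/-! ### Relative weights of the growth rule -/

/-- The parameter `η = -(1-α)/(D-2)` of the model with finite maximal degree `D`. -/
def eta (α : ℝ) (D : ℕ) : ℝ := -((1 - α) / ((D : ℝ) - 2))

/-- Relative probability of selecting a vertex of degree `k ≥ 2` (to attach a new edge to it). -/
def vertexWeight (α : ℝ) (D k : ℕ) : ℝ := eta α D * k + 1 - 2 * eta α D - α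

/-- Relative probability of selecting an inner edge (to graft a new vertex into it). -/
def innerEdgeWeight (α : ℝ) : ℝ := α

/-- Relative probability of selecting a leaf (to graft a new vertex into it). -/
def leafWeight (α : ℝ) (D : ℕ) : ℝ := 1 - eta α D

/-- For `D = 3` a vertex of degree three is never selected for attachment. -/
theorem vertexWeight_three (α : ℝ) : vertexWeight α 3 3 = 0 := by
  unfold vertexWeight eta; push_cast; ring

theorem leafWeight_three_pos {α : ℝ} (h : α ≤ 1) : 0 < leafWeight α 3 := by
  unfold leafWeight eta; push_cast; norm_num; linarith

/-! ### Finite trees -/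

/-- Finite planar rooted trees of maximal degree at most three whose root has degree one. Such a
tree consists of the root, the root edge, and the upper endpoint `v` of the root edge, above which
there are no subtrees (`leaf`), one subtree (`unary`), or a left and a right subtree (`binary`);
each of these subtrees is again a tree of this kind, with `v` as its root. -/
inductive FinTree : Type
  | leaf : FinTree
  | unary : FinTree → FinTree
  | binary : FinTree → FinTree → FinTree

/-- All possible growth moves from a tree (with `D = 3`), each as a pair of the resulting tree and
its relative probability. The constructor `unary` applied to a tree divides its root edge in two.
At a vertex of degree two (the upper endpoint of the root edge of `unary t`) a new edge is attached
in one of two ways, to the left or to the right of `t`, which share the weight of the vertex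
equally. Vertices of degree three have weight zero and give no move, see `vertexWeight_three`. -/
def moves (α : ℝ) : FinTree → List (FinTree × ℝ)
  | .leaf => [(.unary .leaf, leafWeight α 3)]
  | .unary t =>
      (.unary (.unary t), innerEdgeWeight α) ::
      (.binary .leaf t, vertexWeight α 3 2 / 2) ::
      (.binary t .leaf, vertexWeight α 3 2 / 2) ::
      (moves α t).map (fun m => (.unary m.1, m.2))
  | .binary l r =>
      (.unary (.binary l r), innerEdgeWeight α) ::
      ((moves α l).map (fun m => (.binary m.1 r, m.2)) ++
        (moves α r).map (fun m => (.binary l m.1, m.2)))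

theorem exists_leaf_move (α : ℝ) (t : FinTree) : ∃ m ∈ moves α t, m.2 = leafWeight α 3 := by
  induction t with
  | leaf => exact ⟨_, List.mem_singleton.2 rfl, rfl⟩
  | unary t ih =>
    obtain ⟨m, hm, h⟩ := ih
    refine ⟨(.unary m.1, m.2), ?_, h⟩
    simp only [moves, List.mem_cons, List.mem_map]
    exact Or.inr (Or.inr (Or.inr ⟨m, hm, rfl⟩))
  | binary l r ih _ =>
    obtain ⟨m, hm, h⟩ := ih
    refine ⟨(.binary m.1 r, m.2), ?_, h⟩
    simp only [moves, List.mem_cons, List.mem_append, List.mem_map]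
    exact Or.inr (Or.inl ⟨m, hm, rfl⟩)

/-- The weight of the `j`-th move from `t`. -/
def moveWeight (α : ℝ) (t : FinTree) (j : Fin (moves α t).length) : ENNReal :=
  ENNReal.ofReal ((moves α t).get j).2

theorem tsum_moveWeight_ne_zero {α : ℝ} (h : α ≤ 1) (t : FinTree) :
    ∑' j, moveWeight α t j ≠ 0 := by
  obtain ⟨m, hm, hw⟩ := exists_leaf_move α t
  obtain ⟨j, hj⟩ := List.get_of_mem hm
  intro h0
  have h1 := ENNReal.tsum_eq_zero.1 h0 j
  rw [moveWeight, hj, hw, ENNReal.ofReal_eq_zero] at h1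
  exact absurd (leafWeight_three_pos h) (not_lt.2 h1)

theorem tsum_moveWeight_ne_top (α : ℝ) (t : FinTree) : ∑' j, moveWeight α t j ≠ ⊤ := by
  rw [tsum_fintype]
  exact ENNReal.sum_ne_top.2 fun _ _ => ENNReal.ofReal_ne_top

/-- One time step: a move is selected with probability proportional to its weight. -/
def step (α : unitInterval) (t : FinTree) : PMF FinTree :=
  (PMF.normalize (moveWeight α t) (tsum_moveWeight_ne_zero α.2.2 t)
    (tsum_moveWeight_ne_top α t)).map fun j => ((moves α t).get j).1

/-- The law of the tree with `n + 2` edges, started from the unique tree with two edges. -/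
def finLaw (α : unitInterval) : ℕ → PMF FinTree
  | 0 => PMF.pure (.unary .leaf)
  | n + 1 => (finLaw α n).bind (step α)

/-! ### Finite and infinite trees, local topology -/

/-- Finite or infinite planar rooted trees of maximal degree at most three whose root has degree
one, given by the set of their vertices other than the root. A vertex is named by the word that
leads to it: `[]` is the neighbour of the root, and the children of `v` are, from left to right,
`v ++ [false]` and `v ++ [true]`; an only child is `v ++ [false]`. The topology (of pointwise
convergence on words) is that of local convergence: trees converge iff, for every `R`, their balls
of radius `R` around the root are eventually constant. -/
abbrev PlaneTree : Type :=
  {T : List Bool → Bool // T [] = true ∧ (∀ v b, T (v ++ [b]) = true → T v = true) ∧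
    ∀ v, T (v ++ [true]) = true → T (v ++ [false]) = true}

/-- The vertices (other than the root) of a finite tree, as words. -/
def FinTree.mem : FinTree → List Bool → Bool
  | _, [] => true
  | .leaf, _ :: _ => false
  | .unary t, false :: w => t.mem w
  | .unary _, true :: _ => false
  | .binary l _, false :: w => l.mem w
  | .binary _ r, true :: w => r.mem w

theorem FinTree.mem_nil (t : FinTree) : t.mem [] = true := by
  cases t <;> rfl

theorem FinTree.mem_of_append (t : FinTree) (v : List Bool) (b : Bool) :
    t.mem (v ++ [b]) = true → t.mem v = true := by
  induction v generalizing t with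
  | nil => intro _; exact t.mem_nil
  | cons c v ih => cases t <;> cases c <;> simp only [List.cons_append, FinTree.mem] <;>
      first | exact ih _ | exact id

theorem FinTree.mem_left_of_right (t : FinTree) (v : List Bool) :
    t.mem (v ++ [true]) = true → t.mem (v ++ [false]) = true := by
  induction v generalizing t with
  | nil => cases t <;> simp [FinTree.mem, FinTree.mem_nil]
  | cons c v ih => cases t <;> cases c <;> simp only [List.cons_append, FinTree.mem] <;>
      first | exact ih _ | exact id

/-- A finite tree as an element of the space of all trees. -/
def FinTree.toPlaneTree (t : FinTree) : PlaneTree :=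
  ⟨t.mem, t.mem_nil, t.mem_of_append, t.mem_left_of_right⟩

/-- The law of the tree with `n + 2` edges as a measure on the space of all trees. -/
def law (α : unitInterval) (n : ℕ) : ProbabilityMeasure PlaneTree :=
  ⟨((finLaw α n).map FinTree.toPlaneTree).toMeasure, inferInstance⟩

/-! ### The spine and its outgrowths -/

/-- The word formed by the first `i` letters of `p`. -/
def pre (p : ℕ → Bool) (i : ℕ) : List Bool := (List.range i).map p

/-- The vertices `pre p 0, pre p 1, …` all belong to `T`: together with the root they form an
infinite non-backtracking path from the root. -/
def IsInfinitePath (T : PlaneTree) (p : ℕ → Bool) : Prop := ∀ i, T.1 (pre p i) = true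

/-- There is exactly one infinite non-backtracking path from the root, the spine. -/
def HasUniqueSpine (T : PlaneTree) : Prop := ∃! p, IsInfinitePath T p

open Classical in
/-- The spine of a tree that has a unique one (an arbitrary value for other trees). -/
def spine (T : PlaneTree) : ℕ → Bool :=
  if h : HasUniqueSpine T then h.choose else fun _ => false

/-- The `i`-th vertex `s_i` of the spine, `i ≥ 1`, where `s_1` is the neighbour of the root. -/
def spineVertex (T : PlaneTree) (i : ℕ) : List Bool := pre (spine T) (i - 1)

/-- The vertices of the outgrowth `A^i`: the vertex `s_i` together with all its descendants that
are not in the part of the tree starting at `s_{i+1}`. -/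
def outgrowth (T : PlaneTree) (i : ℕ) : Set (List Bool) :=
  {w | T.1 w = true ∧ spineVertex T i <+: w ∧ ¬ spineVertex T (i + 1) <+: w}

/-- `X^i_n`, the number of vertices of the outgrowth `A^i` at distance `n` from `s_i`. -/
def generationSize (i n : ℕ) (T : PlaneTree) : ℕ :=
  {w ∈ outgrowth T i | w.length = (spineVertex T i).length + n}.ncard

end AGModel

end

noncomputable section

namespace AGModel

open scoped NNReal ENNReal


/-! ### Basic facts about finite trees -/

namespace FinTree

/-- The number of edges. -/
def size : FinTree → ℕ
  | leaf => 1
  | unary t => t.size + 1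
  | binary l r => l.size + r.size + 1

/-- The height of the upper endpoint `v` of the root edge, that is, the largest distance of a
descendant of `v` from `v`. -/
def height : FinTree → ℕ
  | leaf => 0
  | unary t => t.height + 1
  | binary l r => max l.height r.height + 1

theorem size_pos (t : FinTree) : 0 < t.size := by cases t <;> simp [size]

theorem length_le_height {t : FinTree} {w : List Bool} (h : t.mem w = true) :
    w.length ≤ t.height := by
  induction w generalizing t with
  | nil => simp
  | cons c w ih =>
    cases t with
    | leaf => simp [mem] at h
    | unary t => cases c <;> simp only [mem, Bool.false_eq_true] at h; simpa [height] using ih h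
    | binary l r =>
      cases c <;> simp only [mem] at h <;> have := ih h <;> simp [height, this]

theorem mem_injective : Function.Injective mem := by
  intro s t h
  have key (w) : s.mem w = t.mem w := congrFun h w
  induction s generalizing t with
  | leaf => cases t with
    | leaf => rfl
    | unary t => simpa [mem, mem_nil] using key [false]
    | binary l r => simpa [mem, mem_nil] using key [false]
  | unary s ih => cases t with
    | leaf => simpa [mem, mem_nil] using key [false]
    | unary t => exact congrArg _ (ih (funext fun w => key (false :: w)) fun w => key (false :: w))
    | binary l r => simpa [mem, mem_nil] using key [true]
  | binary l r ihl ihr => cases t with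
    | leaf => simpa [mem, mem_nil] using key [false]
    | unary t => simpa [mem, mem_nil] using key [true]
    | binary l' r' =>
      rw [ihl (funext fun w => key (false :: w)) fun w => key (false :: w),
        ihr (funext fun w => key (true :: w)) fun w => key (true :: w)]

/-- An injective numbering of the finite trees. -/
def code : FinTree → ℕ
  | leaf => 0
  | unary t => 2 * t.code + 1
  | binary l r => 2 * Nat.pair l.code r.code + 2

theorem code_injective : Function.Injective code := by
  intro s
  induction s with
  | leaf => intro t h; cases t <;> simp [code] at h ⊢
  | unary s ih =>
    intro t h
    cases t with
    | leaf => simp [code] at h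
    | unary t => exact congrArg _ (ih (by simpa [code] using h))
    | binary l r => simp only [code] at h; omega
  | binary l r ihl ihr =>
    intro t h
    cases t with
    | leaf => simp [code] at h
    | unary t => simp only [code] at h; omega
    | binary l' r' =>
      obtain ⟨h1, h2⟩ := Nat.pair_eq_pair.1
        (show Nat.pair l.code r.code = Nat.pair l'.code r'.code by simpa [code] using h)
      rw [ihl h1, ihr h2]

instance : Countable FinTree := code_injective.countable

/-- A tree is a single edge, or has one subtree, or has two subtrees. -/
def equivSum : FinTree ≃ Unit ⊕ (FinTree ⊕ FinTree × FinTree) where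
  toFun
    | leaf => .inl ()
    | unary t => .inr (.inl t)
    | binary l r => .inr (.inr (l, r))
  invFun
    | .inl _ => leaf
    | .inr (.inl t) => unary t
    | .inr (.inr p) => binary p.1 p.2
  left_inv t := by cases t <;> rfl
  right_inv x := by rcases x with _ | _ | _ <;> rfl

theorem tsum_eq (f : FinTree → ℝ≥0∞) :
    ∑' t, f t = f leaf + (∑' t, f (unary t) + ∑' l, ∑' r, f (binary l r)) := by
  rw [← equivSum.symm.tsum_eq, Summable.tsum_sum ENNReal.summable ENNReal.summable,
    Summable.tsum_sum ENNReal.summable ENNReal.summable]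
  congr 1
  · simp [equivSum]
  · congr 1
    exact ENNReal.tsum_prod (f := fun l r => f (binary l r))

end FinTree

/-! ### The law of the finite trees -/

/-- The total weight of all growth histories that turn a vertex of degree two into a branch point
with subtrees of sizes `i` and `j`, divided by the total weights of the histories of the two
subtrees. -/
def branchWeight (a b : ℝ≥0) (i j : ℕ) : ℝ≥0 :=
  b / 2 * (2 * b * (i + j).choose i + a * ((i + j).choose (i + 1) + (i + j).choose (j + 1)))

theorem branchWeight_zero_left (a b : ℝ≥0) (j : ℕ) :
    branchWeight a b 0 j = b / 2 * (2 * b + a * j) := by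
  simp [branchWeight]

theorem branchWeight_comm (a b : ℝ≥0) (i j : ℕ) : branchWeight a b i j = branchWeight a b j i := by
  rw [branchWeight, branchWeight, add_comm j i, add_comm ((i + j).choose (i + 1) : ℝ≥0),
    ← Nat.choose_symm_add]

theorem branchWeight_succ_succ (a b : ℝ≥0) (i j : ℕ) :
    branchWeight a b (i + 1) (j + 1) = branchWeight a b i (j + 1) + branchWeight a b (i + 1) j := by
  have h1 : i + 1 + (j + 1) = (i + j + 1) + 1 := by ring
  have h2 : i + (j + 1) = i + j + 1 := by ring
  have h3 : i + 1 + j = i + j + 1 := by ring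
  simp only [branchWeight, h1, h2, h3, Nat.choose_succ_succ (i + j + 1)]
  push_cast
  ring

/-- The total weight of all growth histories of a tree, started from a single edge. -/
def historyWeight (a b : ℝ≥0) : FinTree → ℝ≥0
  | .leaf => 1
  | .unary t => (2 * b + a * t.size) * historyWeight a b t
  | .binary l r => branchWeight a b l.size r.size * (historyWeight a b l * historyWeight a b r)

/-- The total weight of all growth histories of trees with `m + 1` edges. -/
def partitionFunction (b : ℝ≥0) (m : ℕ) : ℝ≥0 := ∏ j ∈ Finset.range m, ((j : ℝ≥0) + 1 + b)

theorem partitionFunction_pos (b : ℝ≥0) (m : ℕ) : 0 < partitionFunction b m :=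
  Finset.prod_pos fun _ _ => by positivity

theorem partitionFunction_succ (b : ℝ≥0) (m : ℕ) :
    partitionFunction b (m + 1) = partitionFunction b m * (m + 1 + b) :=
  Finset.prod_range_succ _ _

open Classical in
/-- The rate of the growth moves that lead from `t` to `s`. -/
def rate (α : ℝ) (t s : FinTree) : ℝ≥0∞ :=
  ((moves α t).map fun m => if m.1 = s then ENNReal.ofReal m.2 else 0).sum

section rates

variable {α : ℝ} {a b : ℝ≥0}

theorem ofReal_innerEdgeWeight (ha : α = a) : ENNReal.ofReal (innerEdgeWeight α) = a := by
  simp [innerEdgeWeight, ha]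

theorem ofReal_leafWeight (ha : α = a) (hab : a + b = 1) :
    ENNReal.ofReal (leafWeight α 3) = ((2 * b + a : ℝ≥0) : ℝ≥0∞) := by
  have : (a : ℝ) + b = 1 := by exact_mod_cast hab
  rw [← ENNReal.ofReal_coe_nnreal]
  congr 1
  simp only [leafWeight, eta]
  push_cast
  rw [ha]
  linarith

theorem ofReal_vertexWeight (ha : α = a) (hab : a + b = 1) :
    ENNReal.ofReal (vertexWeight α 3 2 / 2) = ((b / 2 : ℝ≥0) : ℝ≥0∞) := by
  have : (a : ℝ) + b = 1 := by exact_mod_cast hab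
  rw [← ENNReal.ofReal_coe_nnreal]
  congr 1
  simp only [vertexWeight, eta]
  push_cast
  rw [ha]
  linarith

theorem rate_leaf_right (t : FinTree) : rate α t .leaf = 0 := by
  cases t <;> simp [rate, moves, Function.comp_def]

open Classical in
theorem rate_leaf_unary (ha : α = a) (hab : a + b = 1) (s : FinTree) :
    rate α .leaf (.unary s) = if .leaf = s then ((2 * b + a : ℝ≥0) : ℝ≥0∞) else 0 := by
  simp only [rate, moves, List.map_cons, List.map_nil, List.sum_cons, List.sum_nil, add_zero,
    ofReal_leafWeight ha hab, FinTree.unary.injEq]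

open Classical in
theorem rate_unary_unary (ha : α = a) (t s : FinTree) :
    rate α (.unary t) (.unary s) = (if .unary t = s then (a : ℝ≥0∞) else 0) + rate α t s := by
  simp [rate, moves, Function.comp_def, ofReal_innerEdgeWeight ha]

open Classical in
theorem rate_binary_unary (ha : α = a) (l r s : FinTree) :
    rate α (.binary l r) (.unary s) = if .binary l r = s then (a : ℝ≥0∞) else 0 := by
  simp [rate, moves, Function.comp_def, ofReal_innerEdgeWeight ha]

theorem rate_leaf_binary (l r : FinTree) : rate α .leaf (.binary l r) = 0 := by
  simp [rate, moves]

open Classical in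
theorem rate_unary_binary (ha : α = a) (hab : a + b = 1) (t l r : FinTree) :
    rate α (.unary t) (.binary l r) =
      (if t = r then (if .leaf = l then ((b / 2 : ℝ≥0) : ℝ≥0∞) else 0) else 0) +
      (if t = l then (if .leaf = r then ((b / 2 : ℝ≥0) : ℝ≥0∞) else 0) else 0) := by
  simp only [rate, moves, List.map_cons, List.sum_cons, List.map_map, Function.comp_def,
    ofReal_vertexWeight ha hab, FinTree.binary.injEq, reduceCtorEq, if_false, zero_add,
    List.map_const', List.sum_replicate, smul_zero, add_zero]
  congr 1
  · split_ifs <;> simp_all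
  · split_ifs <;> simp_all

open Classical in
theorem rate_binary_binary (l r l' r' : FinTree) :
    rate α (.binary l r) (.binary l' r') =
      (if r = r' then rate α l l' else 0) + (if l = l' then rate α r r' else 0) := by
  simp only [rate, moves, List.map_cons, List.sum_cons, List.map_map, Function.comp_def,
    FinTree.binary.injEq, reduceCtorEq, if_false, zero_add, List.map_append, List.sum_append]
  congr 1 <;> split_ifs with h <;> simp [h]

theorem size_of_mem_moves {t : FinTree} {m : FinTree × ℝ} (hm : m ∈ moves α t) :
    m.1.size = t.size + 1 := by
  induction t generalizing m with
  | leaf => simp only [moves, List.mem_singleton] at hm; subst hm; rfl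
  | unary t ih =>
    simp only [moves, List.mem_cons, List.mem_map] at hm
    rcases hm with rfl | rfl | rfl | ⟨m', hm', rfl⟩
    · rfl
    · simp [FinTree.size]; ring
    · simp [FinTree.size]
    · simp [FinTree.size, ih hm']
  | binary l r ihl ihr =>
    simp only [moves, List.mem_cons, List.mem_append, List.mem_map] at hm
    rcases hm with rfl | ⟨m', hm', rfl⟩ | ⟨m', hm', rfl⟩
    · rfl
    · simp [FinTree.size, ihl hm']; ring
    · simp [FinTree.size, ihr hm']; ring

theorem rate_eq_zero {t s : FinTree} (h : s.size ≠ t.size + 1) : rate α t s = 0 := by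
  refine List.sum_eq_zero fun x hx => ?_
  obtain ⟨m, hm, rfl⟩ := List.mem_map.1 hx
  exact if_neg fun e : m.1 = s => h (e ▸ size_of_mem_moves hm)

theorem sum_moves (ha : α = a) (hab : a + b = 1) (t : FinTree) :
    ((moves α t).map fun m => ENNReal.ofReal m.2).sum = ((t.size + b : ℝ≥0) : ℝ≥0∞) := by
  induction t with
  | leaf =>
    simp only [moves, List.map_cons, List.map_nil, List.sum_cons, List.sum_nil, add_zero,
      ofReal_leafWeight ha hab, FinTree.size]
    rw [Nat.cast_one, ← hab]
    congr 1; ring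
  | unary t ih =>
    simp only [moves, List.map_cons, List.sum_cons, List.map_map, Function.comp_def, ih,
      FinTree.size]
    rw [ofReal_innerEdgeWeight ha, ofReal_vertexWeight ha hab, ← ENNReal.coe_add,
      ← ENNReal.coe_add, ← ENNReal.coe_add, Nat.cast_add, Nat.cast_one, ← hab]
    congr 1; ring
  | binary l r ihl ihr =>
    simp only [moves, List.map_cons, List.sum_cons, List.map_append, List.sum_append, List.map_map,
      Function.comp_def, ihl, ihr, FinTree.size]
    rw [ofReal_innerEdgeWeight ha, ← ENNReal.coe_add, ← ENNReal.coe_add, Nat.cast_add,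
      Nat.cast_add, Nat.cast_one, ← hab]
    congr 1; ring

theorem tsum_weight_mul_rate (c : ℕ → ℝ≥0∞) (f : FinTree → ℝ≥0∞) (s : FinTree) :
    ∑' t, c (t.size + 1) * (f t * rate α t s) = c s.size * ∑' t, f t * rate α t s := by
  rw [← ENNReal.tsum_mul_left]
  refine tsum_congr fun t => ?_
  by_cases h : s.size = t.size + 1
  · rw [h]
  · simp [rate_eq_zero h]

/-- The total weight of the histories of a tree is the sum of those of its predecessors. -/
theorem tsum_historyWeight_mul_rate (ha : α = a) (hab : a + b = 1) {s : FinTree} (hs : s ≠ .leaf) :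
    ∑' t, (historyWeight a b t : ℝ≥0∞) * rate α t s = historyWeight a b s := by
  induction s with
  | leaf => exact absurd rfl hs
  | unary s ih =>
    classical
    have hU : ∑' t, (historyWeight a b (.unary t) : ℝ≥0∞) * rate α t s =
        ((2 * b + a * (s.size - 1 : ℕ) : ℝ≥0) : ℝ≥0∞) *
          ∑' t, (historyWeight a b t : ℝ≥0∞) * rate α t s := by
      rw [← tsum_weight_mul_rate fun n => ((2 * b + a * (n - 1 : ℕ) : ℝ≥0) : ℝ≥0∞)]
      refine tsum_congr fun t => ?_
      rw [historyWeight, ENNReal.coe_mul, mul_assoc, Nat.add_sub_cancel]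
    have hsplit : ∑' t, (historyWeight a b t : ℝ≥0∞) * rate α t (.unary s) =
        (if .leaf = s then ((2 * b + a : ℝ≥0) : ℝ≥0∞) else a * historyWeight a b s) +
          ∑' t, (historyWeight a b (.unary t) : ℝ≥0∞) * rate α t s := by
      rw [FinTree.tsum_eq]
      simp only [rate_leaf_unary ha hab, rate_unary_unary ha, rate_binary_unary ha, mul_add,
        ENNReal.tsum_add, mul_ite, mul_zero]
      cases s with
      | leaf => simp [historyWeight]
      | unary s =>
        simp only [FinTree.unary.injEq, reduceCtorEq, if_false, tsum_zero, zero_add, add_zero,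
          tsum_ite_eq]
        rw [mul_comm]
      | binary l r =>
        simp only [FinTree.binary.injEq, reduceCtorEq, if_false, tsum_zero, zero_add]
        rw [add_comm]
        congr 1
        rw [tsum_eq_single l (fun l' h => by simp [h]), tsum_eq_single r (fun r' h => by simp [h])]
        simp only [and_self, if_true]
        rw [mul_comm]
    rw [hsplit, hU]
    by_cases h : s = .leaf
    · subst h
      simp [rate_leaf_right, historyWeight, FinTree.size]
    · rw [if_neg (Ne.symm h), ih h, historyWeight, ← ENNReal.coe_mul, ← ENNReal.coe_mul,
        ← ENNReal.coe_add]
      congr 1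
      obtain ⟨k, hk⟩ := Nat.exists_eq_add_of_lt s.size_pos
      rw [hk]
      push_cast
      simp
      ring
  | binary l r ihl ihr =>
    classical
    have hL : ∑' t, (historyWeight a b (.binary t r) : ℝ≥0∞) * rate α t l +
        (if .leaf = l then ((b / 2 : ℝ≥0) : ℝ≥0∞) else 0) * historyWeight a b (.unary r) =
        ((branchWeight a b (l.size - 1) r.size * (historyWeight a b l * historyWeight a b r) : ℝ≥0)
          : ℝ≥0∞) := by
      have h1 : ∑' t, (historyWeight a b (.binary t r) : ℝ≥0∞) * rate α t l =
          (branchWeight a b (l.size - 1) r.size : ℝ≥0∞) * historyWeight a b r *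
            ∑' t, (historyWeight a b t : ℝ≥0∞) * rate α t l := by
        rw [← tsum_weight_mul_rate fun n =>
          (branchWeight a b (n - 1) r.size : ℝ≥0∞) * historyWeight a b r]
        refine tsum_congr fun t => ?_
        rw [historyWeight, ENNReal.coe_mul, ENNReal.coe_mul, Nat.add_sub_cancel]
        ring
      rw [h1]
      by_cases h : l = .leaf
      · subst h
        simp only [rate_leaf_right, mul_zero, tsum_zero, zero_add, if_true, FinTree.size,
          Nat.sub_self, branchWeight_zero_left, historyWeight, one_mul]
        rw [← ENNReal.coe_mul, mul_assoc]
      · rw [if_neg (Ne.symm h), ihl h, zero_mul, add_zero, ← ENNReal.coe_mul, ← ENNReal.coe_mul]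
        congr 1; ring
    have hR : ∑' t, (historyWeight a b (.binary l t) : ℝ≥0∞) * rate α t r +
        (if .leaf = r then ((b / 2 : ℝ≥0) : ℝ≥0∞) else 0) * historyWeight a b (.unary l) =
        ((branchWeight a b l.size (r.size - 1) * (historyWeight a b l * historyWeight a b r) : ℝ≥0)
          : ℝ≥0∞) := by
      have h1 : ∑' t, (historyWeight a b (.binary l t) : ℝ≥0∞) * rate α t r =
          (branchWeight a b l.size (r.size - 1) : ℝ≥0∞) * historyWeight a b l *
            ∑' t, (historyWeight a b t : ℝ≥0∞) * rate α t r := by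
        rw [← tsum_weight_mul_rate fun n =>
          (branchWeight a b l.size (n - 1) : ℝ≥0∞) * historyWeight a b l]
        refine tsum_congr fun t => ?_
        rw [historyWeight, ENNReal.coe_mul, ENNReal.coe_mul, Nat.add_sub_cancel]
        ring
      rw [h1]
      by_cases h : r = .leaf
      · subst h
        simp only [rate_leaf_right, mul_zero, tsum_zero, zero_add, if_true, FinTree.size,
          Nat.sub_self, branchWeight_comm a b l.size, branchWeight_zero_left,
          historyWeight, mul_one]
        rw [← ENNReal.coe_mul, mul_assoc]
      · rw [if_neg (Ne.symm h), ihr h, zero_mul, add_zero, ← ENNReal.coe_mul, ← ENNReal.coe_mul]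
        congr 1; ring
    have hsplit : ∑' t, (historyWeight a b t : ℝ≥0∞) * rate α t (.binary l r) =
        (∑' t, (historyWeight a b (.binary t r) : ℝ≥0∞) * rate α t l +
          (if .leaf = l then ((b / 2 : ℝ≥0) : ℝ≥0∞) else 0) * historyWeight a b (.unary r)) +
        (∑' t, (historyWeight a b (.binary l t) : ℝ≥0∞) * rate α t r +
          (if .leaf = r then ((b / 2 : ℝ≥0) : ℝ≥0∞) else 0) * historyWeight a b (.unary l)) := by
      rw [FinTree.tsum_eq]
      simp only [rate_leaf_binary, rate_unary_binary ha hab, rate_binary_binary, mul_add,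
        ENNReal.tsum_add, mul_ite, mul_zero, zero_add]
      rw [tsum_ite_eq, tsum_ite_eq, tsum_eq_single l (f := fun l' => ∑' r', if l' = l then _ else _)
        (fun l' h => by simp [h])]
      simp only [tsum_ite_eq, if_true, ite_mul, zero_mul]
      simp only [mul_comm (ENNReal.ofNNReal (b / 2))]
      ring
    rw [hsplit, hL, hR, ← ENNReal.coe_add, historyWeight]
    congr 1
    obtain ⟨i, hi⟩ := Nat.exists_eq_add_of_lt l.size_pos
    obtain ⟨j, hj⟩ := Nat.exists_eq_add_of_lt r.size_pos
    rw [hi, hj]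
    simp only [zero_add, Nat.add_sub_cancel]
    rw [branchWeight_succ_succ]
    ring

end rates

/-- The probability of a tree under the law of the random tree with `m + 1` edges. -/
def treeProb (a b : ℝ≥0) (m : ℕ) (t : FinTree) : ℝ≥0 :=
  if t.size = m + 1 then historyWeight a b t / partitionFunction b m else 0

theorem step_apply {α : unitInterval} {a b : ℝ≥0} (ha : (α : ℝ) = a) (hab : a + b = 1)
    (t s : FinTree) : step α t s = rate α t s * ((t.size + b : ℝ≥0) : ℝ≥0∞)⁻¹ := by
  classical
  rw [step, PMF.map_apply]
  have h1 : ∑' j, moveWeight α t j = ((t.size + b : ℝ≥0) : ℝ≥0∞) := by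
    rw [tsum_fintype, ← sum_moves ha hab, ← Fin.sum_univ_fun_getElem]
    rfl
  simp only [PMF.normalize_apply, h1]
  rw [tsum_fintype, rate, ← Fin.sum_univ_fun_getElem, Finset.sum_mul]
  refine Finset.sum_congr rfl fun j _ => ?_
  simp only [List.get_eq_getElem, ite_mul, zero_mul, moveWeight]
  simp only [eq_comm]

theorem finLaw_apply {α : unitInterval} {a b : ℝ≥0} (ha : (α : ℝ) = a) (hab : a + b = 1)
    (n : ℕ) (s : FinTree) : finLaw α n s = treeProb a b (n + 1) s := by
  induction n generalizing s with
  | zero =>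
    have hpos : (1 + b : ℝ≥0) ≠ 0 := by positivity
    rw [finLaw, PMF.pure_apply, treeProb]
    cases s with
    | leaf => simp [FinTree.size]
    | unary t =>
      cases t with
      | leaf =>
        simp only [if_true, FinTree.size, historyWeight, partitionFunction]
        have : 2 * b + a = 1 + b := by rw [← hab]; ring
        simp [this, hpos]
      | unary t => simp [FinTree.size, t.size_pos.ne']
      | binary l r => simp [FinTree.size, l.size_pos.ne']
    | binary l r =>
      have := l.size_pos
      have := r.size_pos
      rw [if_neg (by simp), if_neg (by simp only [FinTree.size]; omega), ENNReal.coe_zero]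
  | succ n ih =>
    rw [finLaw, PMF.bind_apply]
    by_cases hs : s.size = n + 3
    · have hleaf : s ≠ .leaf := by rintro rfl; simp [FinTree.size] at hs
      have hne : ((n + 2 + b : ℝ≥0)) ≠ 0 := by positivity
      have hterm (t : FinTree) : finLaw α n t * step α t s =
          ((partitionFunction b (n + 2))⁻¹ : ℝ≥0) * (historyWeight a b t * rate α t s) := by
        rw [ih, step_apply ha hab, treeProb]
        by_cases ht : s.size = t.size + 1
        · have ht' : t.size = n + 1 + 1 := by omega
          rw [if_pos ht', ht', partitionFunction_succ b (n + 1), div_eq_mul_inv,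
            ← ENNReal.coe_inv (by push_cast; positivity), mul_inv]
          push_cast
          rw [show (n : ℝ≥0) + 1 + 1 = n + 2 by ring]
          ring
        · simp [rate_eq_zero ht]
      simp only [hterm]
      rw [ENNReal.tsum_mul_left, tsum_historyWeight_mul_rate ha hab hleaf, treeProb, if_pos hs,
        ← ENNReal.coe_mul, div_eq_mul_inv, mul_comm]
    · rw [treeProb, if_neg hs, ENNReal.coe_zero, ENNReal.tsum_eq_zero]
      intro t
      rw [ih, treeProb]
      by_cases ht : t.size = n + 1 + 1
      · rw [step_apply ha hab, rate_eq_zero (by omega)]; simp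
      · simp [ht]

theorem tsum_treeProb {a b : ℝ≥0} (hab : a + b = 1) (m : ℕ) :
    ∑' t, (treeProb a b m t : ℝ≥0∞) = 1 := by
  cases m with
  | zero =>
    rw [tsum_eq_single FinTree.leaf]
    · simp [treeProb, FinTree.size, historyWeight, partitionFunction]
    · intro t ht
      cases t with
      | leaf => exact absurd rfl ht
      | unary t => simp [treeProb, FinTree.size, t.size_pos.ne']
      | binary l r => simp [treeProb, FinTree.size, l.size_pos.ne']
  | succ n =>
    have h1 : (a : ℝ) ≤ 1 := by
      have : a ≤ 1 := hab ▸ le_self_add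
      exact_mod_cast this
    simpa only [finLaw_apply (α := ⟨a, a.2, h1⟩) rfl hab] using (finLaw ⟨a, a.2, h1⟩ n).tsum_coe


/-! ### The law of the outgrowths -/

/-- The probability of a tree under the law of a nonempty outgrowth in the infinite tree. -/
def outgrowthProb (a b : ℝ≥0) (t : FinTree) : ℝ≥0 :=
  a * historyWeight a b t / (t.size + 1).factorial

theorem tendsto_partitionFunction_div_factorial {a b : ℝ≥0} (ha : 0 < a) (hab : a + b = 1) :
    Tendsto (fun m => partitionFunction b m / ((m + 1).factorial : ℝ≥0)) atTop (𝓝 0) := by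
  have hab' : (a : ℝ) + b = 1 := by exact_mod_cast hab
  have hle (m : ℕ) : (partitionFunction b m : ℝ) / (m + 1).factorial ≤
      Real.exp (-(a / 2 * ∑ i ∈ Finset.range m, 1 / ((i : ℝ) + 1))) := by
    induction m with
    | zero => simp [partitionFunction]
    | succ m ih =>
      have h1 : (partitionFunction b (m + 1) : ℝ) / (m + 1 + 1).factorial =
          partitionFunction b m / (m + 1).factorial * ((m + 1 + b) / (m + 2)) := by
        rw [partitionFunction_succ, Nat.factorial_succ (m + 1)]
        push_cast
        rw [mul_comm ((m : ℝ) + 1 + 1), mul_div_mul_comm]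
        congr 2; ring
      have h2 : ((m : ℝ) + 1 + b) / (m + 2) ≤ Real.exp (-(a / 2 * (1 / ((m : ℝ) + 1)))) := by
        refine le_trans ?_ (Real.add_one_le_exp _)
        have hm : (0 : ℝ) ≤ m := Nat.cast_nonneg m
        have ha0 : (0 : ℝ) ≤ a := a.2
        rw [div_le_iff₀ (by positivity)]
        have h3 : (a : ℝ) / 2 * (1 / ((m : ℝ) + 1)) * (m + 2) ≤ a := by
          rw [div_mul_div_comm, div_mul_eq_mul_div, div_le_iff₀ (by positivity)]
          nlinarith
        nlinarith
      rw [h1, Finset.sum_range_succ, mul_add, neg_add, Real.exp_add]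
      exact mul_le_mul ih h2 (by positivity) (Real.exp_pos _).le
  have hlim : Tendsto
      (fun m => Real.exp (-((a : ℝ) / 2 * ∑ i ∈ Finset.range m, 1 / ((i : ℝ) + 1))))
      atTop (𝓝 0) := by
    refine Real.tendsto_exp_neg_atTop_nhds_zero.comp ?_
    exact Real.tendsto_sum_range_one_div_nat_succ_atTop.const_mul_atTop
      (half_pos (NNReal.coe_pos.2 ha))
  rw [← NNReal.tendsto_coe]
  push_cast
  exact squeeze_zero (fun m => by positivity) hle hlim

theorem tsum_partitionFunction_div_factorial {a b : ℝ≥0} (ha : 0 < a) (hab : a + b = 1) :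
    ∑' m, ((a * partitionFunction b m / (m + 2).factorial : ℝ≥0) : ℝ≥0∞) = 1 := by
  have hsum (N : ℕ) : (∑ m ∈ Finset.range N, a * partitionFunction b m / (m + 2).factorial) +
      partitionFunction b N / (N + 1).factorial = 1 := by
    induction N with
    | zero => simp [partitionFunction]
    | succ N ih =>
      rw [← ih, Finset.sum_range_succ, add_assoc]
      congr 1
      rw [partitionFunction_succ, Nat.factorial_succ (N + 1), ← add_div,
        div_eq_div_iff (by positivity) (by positivity)]
      push_cast
      rw [show ((N : ℝ≥0) + 1 + 1) = N + 1 + (a + b) by rw [hab]]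
      ring
  have hreal : HasSum (fun m => ((a * partitionFunction b m / (m + 2).factorial : ℝ≥0) : ℝ)) 1 := by
    rw [hasSum_iff_tendsto_nat_of_nonneg (fun m => NNReal.coe_nonneg _)]
    have h1 : Tendsto (fun N => (1 : ℝ) - ((partitionFunction b N / (N + 1).factorial : ℝ≥0) : ℝ))
        atTop (𝓝 (1 - 0)) :=
      tendsto_const_nhds.sub
        (NNReal.tendsto_coe.2 (tendsto_partitionFunction_div_factorial ha hab))
    rw [sub_zero] at h1
    refine h1.congr fun N => ?_
    rw [sub_eq_iff_eq_add]
    exact_mod_cast (hsum N).symm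
  have : HasSum (fun m => (a * partitionFunction b m / (m + 2).factorial : ℝ≥0)) 1 := by
    rw [← NNReal.hasSum_coe]; exact hreal
  exact_mod_cast (ENNReal.hasSum_coe.2 this).tsum_eq

theorem tsum_outgrowthProb {a b : ℝ≥0} (ha : 0 < a) (hab : a + b = 1) :
    ∑' t, (outgrowthProb a b t : ℝ≥0∞) = 1 := by
  have h (t : FinTree) : (outgrowthProb a b t : ℝ≥0∞) =
      ∑' m, ((a * partitionFunction b m / (m + 2).factorial : ℝ≥0) : ℝ≥0∞) * treeProb a b m t := by
    obtain ⟨k, hk⟩ := Nat.exists_eq_add_of_lt t.size_pos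
    rw [tsum_eq_single k]
    · rw [← ENNReal.coe_mul, treeProb, if_pos (by omega), outgrowthProb, hk]
      congr 1
      have := (partitionFunction_pos b k).ne'
      rw [zero_add]
      field_simp
    · intro m hm
      rw [treeProb, if_neg (by omega)]; simp
  simp only [h]
  rw [ENNReal.tsum_comm]
  simp only [ENNReal.tsum_mul_left, tsum_treeProb hab, mul_one]
  exact tsum_partitionFunction_div_factorial ha hab

theorem outgrowthProb_unary_le {a b : ℝ≥0} (hba : b ≤ a) (t : FinTree) :
    outgrowthProb a b (.unary t) ≤ a * outgrowthProb a b t := by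
  simp only [outgrowthProb, historyWeight, FinTree.size]
  rw [Nat.factorial_succ (t.size + 1), ← mul_div_assoc,
    div_le_div_iff₀ (by positivity) (by positivity)]
  push_cast
  have h : 2 * b + a * (t.size : ℝ≥0) ≤ a * (t.size + 1 + 1) := by
    calc 2 * b + a * (t.size : ℝ≥0) ≤ 2 * a + a * t.size := by gcongr
      _ = _ := by ring
  calc a * ((2 * b + a * (t.size : ℝ≥0)) * historyWeight a b t) * (t.size + 1).factorial
      ≤ a * ((a * (t.size + 1 + 1)) * historyWeight a b t) * (t.size + 1).factorial := by gcongr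
    _ = _ := by ring

theorem branchWeight_le {a b : ℝ≥0} (hba : b ≤ a) (i j : ℕ) :
    branchWeight a b i j ≤ b / 2 * (a * (i + j + 2).choose (i + 1)) := by
  have h : ((i + j + 2).choose (i + 1) : ℝ≥0) =
      2 * (i + j).choose i + ((i + j).choose (i + 1) + (i + j).choose (j + 1)) := by
    have h1 : (i + j + 2).choose (i + 1) = (i + j + 1).choose i + (i + j + 1).choose j := by
      rw [Nat.choose_succ_succ, Nat.choose_symm_of_eq_add (show i + j + 1 = j + (i + 1) by ring)]
    cases i with
    | zero => simp; ring
    | succ i => cases j with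
      | zero => simp; ring
      | succ j =>
        rw [h1, Nat.choose_succ_succ _ i, Nat.choose_succ_succ _ j,
          Nat.choose_symm_of_eq_add (show i + 1 + (j + 1) = i + (j + 1 + 1) by ring),
          Nat.choose_symm_of_eq_add (show i + 1 + (j + 1) = j + (i + 1 + 1) by ring),
          Nat.choose_symm_of_eq_add (show i + 1 + (j + 1) = (j + 1) + (i + 1) by ring)]
        push_cast
        ring
  rw [h, branchWeight]
  gcongr
  calc 2 * b * ((i + j).choose i : ℝ≥0) + a * ((i + j).choose (i + 1) + (i + j).choose (j + 1))
      ≤ 2 * a * ((i + j).choose i : ℝ≥0) +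
          a * ((i + j).choose (i + 1) + (i + j).choose (j + 1)) := by
        gcongr
    _ = _ := by ring

theorem outgrowthProb_binary_le {a b : ℝ≥0} (hba : b ≤ a) (l r : FinTree) :
    outgrowthProb a b (.binary l r) ≤ b / 2 * (outgrowthProb a b l * outgrowthProb a b r) := by
  simp only [outgrowthProb, historyWeight, FinTree.size]
  have hf : ((l.size + r.size + 1 + 1).factorial : ℝ≥0) =
      (l.size + r.size + 2).choose (l.size + 1) * (l.size + 1).factorial *
        (r.size + 1).factorial := by
    rw [show l.size + r.size + 1 + 1 = (l.size + 1) + (r.size + 1) by ring, Nat.choose_symm_add]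
    exact_mod_cast (Nat.add_choose_mul_factorial_mul_factorial _ _).symm
  rw [div_mul_div_comm, ← mul_div_assoc, div_le_div_iff₀ (by positivity) (by positivity), hf]
  calc a * (branchWeight a b l.size r.size * (historyWeight a b l * historyWeight a b r)) *
        ((l.size + 1).factorial * (r.size + 1).factorial)
      ≤ a * (b / 2 * (a * (l.size + r.size + 2).choose (l.size + 1)) *
          (historyWeight a b l * historyWeight a b r)) *
        ((l.size + 1).factorial * (r.size + 1).factorial) := by
        gcongr; exact branchWeight_le hba _ _
    _ = _ := by ring

/-- The probability that a nonempty outgrowth has height at least `n`, not counting its first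
edge. -/
def heightTail (a b : ℝ≥0) (n : ℕ) : ℝ≥0∞ :=
  ∑' t : FinTree, if n ≤ t.height then (outgrowthProb a b t : ℝ≥0∞) else 0

theorem heightTail_zero {a b : ℝ≥0} (ha : 0 < a) (hab : a + b = 1) : heightTail a b 0 = 1 := by
  simp [heightTail, tsum_outgrowthProb ha hab]

theorem heightTail_le_one {a b : ℝ≥0} (ha : 0 < a) (hab : a + b = 1) (n : ℕ) :
    heightTail a b n ≤ 1 := by
  rw [← tsum_outgrowthProb ha hab]
  exact ENNReal.tsum_le_tsum fun t => by split_ifs <;> simp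

theorem tsum_tsum_max_height {a b : ℝ≥0} (ha : 0 < a) (hab : a + b = 1) (n : ℕ) :
    (∑' l : FinTree, ∑' r : FinTree, if n ≤ max l.height r.height then
      (outgrowthProb a b l : ℝ≥0∞) * outgrowthProb a b r else 0) +
      heightTail a b n * heightTail a b n = 2 * heightTail a b n := by
  have h1 : heightTail a b n = ∑' l : FinTree, ∑' r : FinTree,
      (if n ≤ l.height then (outgrowthProb a b l : ℝ≥0∞) else 0) * outgrowthProb a b r := by
    simp only [ENNReal.tsum_mul_left, tsum_outgrowthProb ha hab, mul_one]; rfl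
  have h2 : heightTail a b n = ∑' l : FinTree, ∑' r : FinTree,
      (outgrowthProb a b l : ℝ≥0∞) *
        (if n ≤ r.height then (outgrowthProb a b r : ℝ≥0∞) else 0) := by
    simp only [ENNReal.tsum_mul_left, ENNReal.tsum_mul_right, tsum_outgrowthProb ha hab, one_mul]
    rfl
  have h3 : heightTail a b n * heightTail a b n = ∑' l : FinTree, ∑' r : FinTree,
      (if n ≤ l.height then (outgrowthProb a b l : ℝ≥0∞) else 0) *
        (if n ≤ r.height then (outgrowthProb a b r : ℝ≥0∞) else 0) := by
    simp only [ENNReal.tsum_mul_left, ENNReal.tsum_mul_right]; rfl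
  rw [h3, two_mul]
  nth_rw 1 [h1]
  rw [h2]
  simp only [← ENNReal.tsum_add]
  refine tsum_congr fun l => tsum_congr fun r => ?_
  by_cases hl : n ≤ l.height <;> by_cases hr : n ≤ r.height <;> simp [hl, hr]

theorem heightTail_succ_add_le {a b : ℝ≥0} (ha : 0 < a) (hab : a + b = 1) (hba : b ≤ a) (n : ℕ) :
    heightTail a b (n + 1) + (b / 2 : ℝ≥0) * (heightTail a b n * heightTail a b n) ≤
      heightTail a b n := by
  have h1 : heightTail a b (n + 1) ≤ a * heightTail a b n +
      (b / 2 : ℝ≥0) * ∑' l : FinTree, ∑' r : FinTree, if n ≤ max l.height r.height then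
        (outgrowthProb a b l : ℝ≥0∞) * outgrowthProb a b r else 0 := by
    rw [heightTail, FinTree.tsum_eq]
    rw [if_neg (by simp [FinTree.height]), zero_add]
    simp only [FinTree.height, Nat.succ_le_succ_iff]
    rw [heightTail]
    simp only [← ENNReal.tsum_mul_left]
    gcongr with t l r
    · split_ifs
      · exact_mod_cast outgrowthProb_unary_le hba t
      · simp
    · split_ifs
      · exact_mod_cast outgrowthProb_binary_le hba l r
      · simp
  calc _ ≤ _ := add_le_add_left h1 _
    _ = a * heightTail a b n + (b / 2 : ℝ≥0) * (2 * heightTail a b n) := by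
        rw [add_assoc, ← mul_add, tsum_tsum_max_height ha hab]
    _ = ((a + b / 2 * 2 : ℝ≥0) : ℝ≥0∞) * heightTail a b n := by push_cast; ring
    _ = heightTail a b n := by rw [div_mul_cancel₀ _ two_ne_zero, hab]; simp

/-- The probability that the outgrowth at a given spine vertex has height greater than `n`. -/
theorem mul_heightTail_le {a b : ℝ≥0} (ha : 0 < a) (hab : a + b = 1) (hba : b ≤ a) (n : ℕ) :
    (b : ℝ) * (heightTail a b n).toReal ≤ 2 / (n + 4) := by
  have hab' : (a : ℝ) + b = 1 := by exact_mod_cast hab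
  have hba' : (b : ℝ) ≤ a := by exact_mod_cast hba
  have hfin (n : ℕ) : heightTail a b n ≠ ⊤ :=
    ((heightTail_le_one ha hab n).trans_lt ENNReal.one_lt_top).ne
  induction n with
  | zero => rw [heightTail_zero ha hab]; norm_num; linarith
  | succ n ih =>
    have h := ENNReal.toReal_mono (hfin n) (heightTail_succ_add_le ha hab hba n)
    rw [ENNReal.toReal_add (hfin _) (by finiteness [hfin n]), ENNReal.toReal_mul,
      ENNReal.toReal_mul,
      ENNReal.coe_toReal] at h
    push_cast at h
    set x := (heightTail a b n).toReal
    set x' := (heightTail a b (n + 1)).toReal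
    have hb : (0 : ℝ) ≤ b := b.2
    have h1 : (b : ℝ) * x' ≤ b * x - (b * x) ^ 2 / 2 := by nlinarith
    have hn : (0 : ℝ) ≤ n := Nat.cast_nonneg n
    set y := (2 : ℝ) / (n + 4) with hy
    have hy1 : y ≤ 1 := by rw [hy, div_le_one (by positivity)]; linarith
    have h2 : (b : ℝ) * x - (b * x) ^ 2 / 2 ≤ y - y ^ 2 / 2 := by
      nlinarith
    have h3 : y - y ^ 2 / 2 ≤ 2 / ((n + 1 : ℕ) + 4) := by
      rw [hy]
      push_cast
      rw [div_pow, div_div, div_sub_div _ _ (by positivity) (by positivity),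
        div_le_div_iff₀ (by positivity) (by positivity)]
      nlinarith [pow_nonneg hn 2, pow_nonneg hn 3]
    linarith


/-! ### Trees with a spine -/

instance : MeasurableSpace FinTree := ⊤

instance : DiscreteMeasurableSpace FinTree := ⟨fun _ => trivial⟩

/-- The outgrowth at a spine vertex: none, or a tree on the left (`false`) or on the right (`true`)
of the spine. -/
abbrev Outgrowth : Type := Option (Bool × FinTree)

instance : MeasurableSpace Outgrowth := ⊤

instance : DiscreteMeasurableSpace Outgrowth := ⟨fun _ => trivial⟩

/-- The direction in which the spine continues at a vertex with the given outgrowth. -/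
def Outgrowth.direction : Outgrowth → Bool
  | none => false
  | some (c, _) => !c

/-- The sequence of outgrowths without its first term. -/
def tail (ξ : ℕ → Outgrowth) : ℕ → Outgrowth := fun i => ξ (i + 1)

/-- The sequence of outgrowths with first term `x`. -/
def cons (x : Outgrowth) (ξ : ℕ → Outgrowth) : ℕ → Outgrowth
  | 0 => x
  | i + 1 => ξ i

/-- The vertices of the tree that consists of a spine with given outgrowths. -/
def spineMem : List Bool → (ℕ → Outgrowth) → Bool
  | [], _ => true
  | b :: w, ξ =>
    match ξ 0 with
    | none => !b && spineMem w (tail ξ)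
    | some (c, t) => if b = c then t.mem w else spineMem w (tail ξ)

/-- Words which leave the spine at its first vertex. -/
theorem spineMem_cons_ne {ξ : ℕ → Outgrowth} {b : Bool} (hb : b ≠ (ξ 0).direction) (w : List Bool) :
    spineMem (b :: w) ξ = true ↔ ∃ t, ξ 0 = some (b, t) ∧ t.mem w = true := by
  rcases h : ξ 0 with _ | ⟨c, t⟩
  · rw [h] at hb; simp [spineMem, h]; simp [Outgrowth.direction] at hb; simp [hb]
  · rw [h] at hb
    have : b = c := by revert hb; cases b <;> cases c <;> simp [Outgrowth.direction]
    subst this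
    simp [spineMem, h]

/-- Words which follow the spine at its first vertex. -/
theorem spineMem_cons_eq {ξ : ℕ → Outgrowth} {b : Bool} (hb : b = (ξ 0).direction) (w : List Bool) :
    spineMem (b :: w) ξ = spineMem w (tail ξ) := by
  rcases h : ξ 0 with _ | ⟨c, t⟩
  · rw [h] at hb; subst hb; simp [spineMem, h, Outgrowth.direction]
  · rw [h] at hb; subst hb; simp [spineMem, h, Outgrowth.direction]

theorem spineMem_of_append (v : List Bool) (b : Bool) (ξ : ℕ → Outgrowth) :
    spineMem (v ++ [b]) ξ = true → spineMem v ξ = true := by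
  induction v generalizing ξ with
  | nil => intro _; rfl
  | cons c v ih =>
    by_cases hc : c = (ξ 0).direction
    · rw [List.cons_append, spineMem_cons_eq hc, spineMem_cons_eq hc]; exact ih _
    · rw [List.cons_append, spineMem_cons_ne hc, spineMem_cons_ne hc]
      exact fun ⟨t, h, h'⟩ => ⟨t, h, t.mem_of_append v b h'⟩

theorem spineMem_left_of_right (v : List Bool) (ξ : ℕ → Outgrowth) :
    spineMem (v ++ [true]) ξ = true → spineMem (v ++ [false]) ξ = true := by
  induction v generalizing ξ with
  | nil =>
    rcases h : ξ 0 with _ | ⟨c, t⟩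
    · simp [spineMem, h]
    · simp [spineMem, h, FinTree.mem_nil]
  | cons c v ih =>
    by_cases hc : c = (ξ 0).direction
    · rw [List.cons_append, List.cons_append, spineMem_cons_eq hc, spineMem_cons_eq hc]; exact ih _
    · rw [List.cons_append, List.cons_append, spineMem_cons_ne hc, spineMem_cons_ne hc]
      exact fun ⟨t, h, h'⟩ => ⟨t, h, t.mem_left_of_right v h'⟩

/-- The tree that consists of a spine with given outgrowths. -/
def spineTree (ξ : ℕ → Outgrowth) : PlaneTree :=
  ⟨fun w => spineMem w ξ, rfl, fun v b => spineMem_of_append v b ξ,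
    fun v => spineMem_left_of_right v ξ⟩

/-- The spine of `spineTree ξ`. -/
def spinePath (ξ : ℕ → Outgrowth) (i : ℕ) : Bool := (ξ i).direction

theorem pre_succ (p : ℕ → Bool) (i : ℕ) : pre p (i + 1) = p 0 :: pre (fun k => p (k + 1)) i := by
  simp [pre, List.range_succ_eq_map, Function.comp_def]

theorem pre_length (p : ℕ → Bool) (i : ℕ) : (pre p i).length = i := by simp [pre]

theorem isInfinitePath_spinePath (ξ : ℕ → Outgrowth) :
    IsInfinitePath (spineTree ξ) (spinePath ξ) := by
  intro i
  change spineMem _ ξ = true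
  induction i generalizing ξ with
  | zero => rfl
  | succ i ih =>
    rw [pre_succ, spineMem_cons_eq (show spinePath ξ 0 = _ from rfl)]
    exact ih (tail ξ)

theorem apply_zero_of_isInfinitePath {ξ : ℕ → Outgrowth} {p : ℕ → Bool}
    (hp : IsInfinitePath (spineTree ξ) p) : p 0 = (ξ 0).direction := by
  by_contra h
  have key (k : ℕ) : ∃ t, ξ 0 = some (p 0, t) ∧ t.mem (pre (fun k => p (k + 1)) k) = true := by
    have := hp (k + 1)
    rw [pre_succ] at this
    exact (spineMem_cons_ne h _).1 this
  obtain ⟨t, ht, -⟩ := key 0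
  obtain ⟨t', ht', hm⟩ := key (t.height + 1)
  have : t' = t := by simpa [ht, eq_comm] using ht'
  subst this
  have := FinTree.length_le_height hm
  rw [pre_length] at this
  omega

theorem eq_spinePath {ξ : ℕ → Outgrowth} {p : ℕ → Bool} (hp : IsInfinitePath (spineTree ξ) p) :
    p = spinePath ξ := by
  funext i
  induction i generalizing ξ p with
  | zero => exact apply_zero_of_isInfinitePath hp
  | succ i ih =>
    refine ih (ξ := tail ξ) (p := fun k => p (k + 1)) fun k => ?_
    have := hp (k + 1)
    rw [pre_succ] at this
    exact (spineMem_cons_eq (apply_zero_of_isInfinitePath hp) _).symm.trans this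

theorem hasUniqueSpine_spineTree (ξ : ℕ → Outgrowth) : HasUniqueSpine (spineTree ξ) :=
  ⟨spinePath ξ, isInfinitePath_spinePath ξ, fun _ h => eq_spinePath h⟩

theorem spine_spineTree (ξ : ℕ → Outgrowth) : spine (spineTree ξ) = spinePath ξ := by
  rw [spine, dif_pos (hasUniqueSpine_spineTree ξ)]
  exact eq_spinePath (hasUniqueSpine_spineTree ξ).choose_spec.1

theorem spineTree_injective : Function.Injective spineTree := by
  have hdir {ξ ζ : ℕ → Outgrowth} (h : spineTree ξ = spineTree ζ) :
      (ξ 0).direction = (ζ 0).direction :=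
    apply_zero_of_isInfinitePath (h ▸ isInfinitePath_spinePath ξ)
  intro ξ ζ h
  funext i
  induction i generalizing ξ ζ with
  | zero =>
    have hd := hdir h
    have key (w) : spineMem ((!(ξ 0).direction) :: w) ξ = spineMem ((!(ξ 0).direction) :: w) ζ :=
      congrFun (congrArg Subtype.val h) (_ :: w)
    have key' (w) : (∃ t, ξ 0 = some (!(ξ 0).direction, t) ∧ t.mem w = true) ↔
        ∃ t, ζ 0 = some (!(ξ 0).direction, t) ∧ t.mem w = true := by
      rw [← spineMem_cons_ne (by simp), key, spineMem_cons_ne (by simp [hd])]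
    rcases hξ : ξ 0 with _ | ⟨c, t⟩ <;> rcases hζ : ζ 0 with _ | ⟨c', t'⟩
    · rfl
    · rw [hξ, hζ] at hd key'
      have : c' = true := by
        revert hd; cases c' <;> simp [Outgrowth.direction]
      simpa [Outgrowth.direction, this, FinTree.mem_nil] using key' []
    · rw [hξ, hζ] at hd key'
      simpa [FinTree.mem_nil, Outgrowth.direction] using key' []
    · rw [hξ, hζ] at hd key'
      have hc : c = c' := by simpa [Outgrowth.direction] using hd
      subst hc
      have : t = t' := FinTree.mem_injective (funext fun w => by
        rw [Bool.eq_iff_iff]; simpa [Outgrowth.direction] using key' w)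
      rw [this]
  | succ i ih =>
    have hd := hdir h
    refine ih (ξ := tail ξ) (ζ := tail ζ) (Subtype.ext (funext fun w => ?_))
    have := congrFun (congrArg Subtype.val h) ((ξ 0).direction :: w)
    exact (spineMem_cons_eq rfl w).symm.trans (this.trans (spineMem_cons_eq hd w))

/-- A word that leaves the spine at its vertex number `i`. -/
theorem exists_outgrowth_of_spineMem {ξ : ℕ → Outgrowth} {i : ℕ} {w : List Bool}
    (hw : spineMem w ξ = true) (h1 : pre (spinePath ξ) i <+: w)
    (h2 : ¬ pre (spinePath ξ) (i + 1) <+: w) (hlen : i < w.length) :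
    ∃ c t, ξ i = some (c, t) ∧ w.length ≤ i + 1 + t.height := by
  induction i generalizing ξ w with
  | zero =>
    obtain _ | ⟨b, w⟩ := w
    · simp at hlen
    · have hb : b ≠ (ξ 0).direction := by
        rintro rfl
        apply h2
        rw [pre_succ]
        simp [pre, spinePath]
      obtain ⟨t, ht, hm⟩ := (spineMem_cons_ne hb w).1 hw
      refine ⟨b, t, ht, ?_⟩
      have := FinTree.length_le_height hm
      simp only [List.length_cons]
      omega
  | succ i ih =>
    obtain _ | ⟨b, w⟩ := w
    · simp at hlen
    · rw [pre_succ, List.cons_prefix_cons] at h1 h2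
      obtain ⟨hb, h1⟩ := h1
      have hb' : b = (ξ 0).direction := hb.symm
      obtain ⟨c, t, ht, hl⟩ := ih (ξ := tail ξ) (w := w) ((spineMem_cons_eq hb' w).symm.trans hw) h1
        (fun h => h2 ⟨hb, h⟩) (by simpa using hlen)
      refine ⟨c, t, ht, ?_⟩
      simp only [List.length_cons]
      omega

theorem exists_outgrowth_of_generationSize_pos {ξ : ℕ → Outgrowth} {i n : ℕ}
    (h : 0 < generationSize (i + 1) (n + 1) (spineTree ξ)) :
    ∃ c t, ξ i = some (c, t) ∧ n ≤ t.height := by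
  obtain ⟨w, ⟨hw, h1, h2⟩, hl⟩ := Set.nonempty_of_ncard_ne_zero h.ne'
  simp only [spineVertex, spine_spineTree, Nat.add_sub_cancel, pre_length] at h1 h2 hl
  obtain ⟨c, t, ht, hle⟩ := exists_outgrowth_of_spineMem hw h1 h2 (by omega)
  exact ⟨c, t, ht, by omega⟩

theorem measurable_tail : Measurable tail :=
  measurable_pi_lambda _ fun i => measurable_pi_apply (i + 1)

theorem measurable_spineMem (w : List Bool) : Measurable (spineMem w) := by
  induction w with
  | nil => exact measurable_const
  | cons b w ih =>
    have : Measurable fun q : Outgrowth × (ℕ → Outgrowth) =>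
        (match q.1 with
        | none => !b && spineMem w q.2
        | some (c, t) => if b = c then t.mem w else spineMem w q.2 : Bool) := by
      refine measurable_from_prod_countable_right fun x => ?_
      rcases x with _ | ⟨c, t⟩
      · exact (measurable_of_countable fun e : Bool => !b && e).comp ih
      · by_cases h : b = c
        · simp only [h, if_true]; exact measurable_const
        · simp only [h, if_false]; exact ih
    exact this.comp ((measurable_pi_apply 0).prodMk measurable_tail)

theorem measurable_spineTree : Measurable spineTree :=
  (measurable_pi_lambda _ measurable_spineMem).subtype_mk

theorem measurableEmbedding_spineTree : MeasurableEmbedding spineTree :=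
  measurable_spineTree.measurableEmbedding spineTree_injective


/-! ### The law of the infinite tree -/

theorem tsum_outgrowth (f : Outgrowth → ℝ≥0∞) :
    ∑' x, f x = f none + (∑' t, f (some (false, t)) + ∑' t, f (some (true, t))) := by
  rw [← (Equiv.optionEquivSumPUnit.{0} (Bool × FinTree)).symm.tsum_eq,
    Summable.tsum_sum ENNReal.summable ENNReal.summable, add_comm]
  congr 1
  · simp
  · simp only [Equiv.optionEquivSumPUnit_symm_inl]
    rw [ENNReal.tsum_prod (f := fun c t => f (some (c, t))), tsum_bool]

/-- The probabilities of the outgrowths at a given spine vertex. -/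
def outgrowthMass (a b : ℝ≥0) : Outgrowth → ℝ≥0
  | none => a
  | some (_, t) => b / 2 * outgrowthProb a b t

theorem tsum_outgrowthMass {a b : ℝ≥0} (ha : 0 < a) (hab : a + b = 1) :
    ∑' x, (outgrowthMass a b x : ℝ≥0∞) = 1 := by
  rw [tsum_outgrowth]
  simp only [outgrowthMass, ENNReal.coe_mul, ENNReal.tsum_mul_left, tsum_outgrowthProb ha hab,
    mul_one]
  rw [← ENNReal.coe_add, add_halves, ← ENNReal.coe_add, hab, ENNReal.coe_one]

/-- The law of the outgrowth at a given spine vertex. -/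
def outgrowthLaw {a b : ℝ≥0} (ha : 0 < a) (hab : a + b = 1) : PMF Outgrowth :=
  ⟨fun x => outgrowthMass a b x, ENNReal.summable.hasSum_iff.2 (tsum_outgrowthMass ha hab)⟩

/-- The law of a sequence of independent outgrowths. -/
def outgrowthsLaw {a b : ℝ≥0} (ha : 0 < a) (hab : a + b = 1) : Measure (ℕ → Outgrowth) :=
  Measure.infinitePi fun _ => (outgrowthLaw ha hab).toMeasure

instance {a b : ℝ≥0} (ha : 0 < a) (hab : a + b = 1) :
    IsProbabilityMeasure (outgrowthsLaw ha hab) := by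
  unfold outgrowthsLaw; infer_instance

theorem measurable_cons : Measurable fun q : Outgrowth × (ℕ → Outgrowth) => cons q.1 q.2 := by
  refine measurable_pi_lambda _ fun i => ?_
  cases i with
  | zero => exact measurable_fst
  | succ i => exact (measurable_pi_apply i).comp measurable_snd

theorem map_cons_outgrowthsLaw {a b : ℝ≥0} (ha : 0 < a) (hab : a + b = 1) :
    ((outgrowthLaw ha hab).toMeasure.prod (outgrowthsLaw ha hab)).map (fun q => cons q.1 q.2) =
      outgrowthsLaw ha hab := by
  refine Measure.eq_infinitePi _ fun s t ht => ?_
  classical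
  obtain ⟨N, hN⟩ : ∃ N, s ⊆ Finset.range (N + 1) :=
    ⟨s.sup id, fun i hi => Finset.mem_range_succ_iff.2 (Finset.le_sup (f := id) hi)⟩
  set t' : ℕ → Set Outgrowth := fun i => if i ∈ s then t i else Set.univ with ht'
  have ht'm (i : ℕ) : MeasurableSet (t' i) := MeasurableSet.of_discrete
  have hset : Set.pi (s : Set ℕ) t = Set.pi (Finset.range (N + 1) : Set ℕ) t' := by
    ext ξ
    simp only [Set.mem_pi, Finset.mem_coe, ht']
    constructor
    · intro h i _
      split_ifs with hi
      · exact h i hi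
      · trivial
    · intro h i hi
      simpa [hi] using h i (hN hi)
  have hprod : ∏ i ∈ s, (outgrowthLaw ha hab).toMeasure (t i) =
      ∏ i ∈ Finset.range (N + 1), (outgrowthLaw ha hab).toMeasure (t' i) := by
    rw [← Finset.prod_subset hN (fun i _ hi => by simp [ht', hi])]
    exact Finset.prod_congr rfl fun i hi => by simp [ht', hi]
  have hpre : (fun q : Outgrowth × (ℕ → Outgrowth) => cons q.1 q.2) ⁻¹'
      Set.pi (Finset.range (N + 1) : Set ℕ) t' =
      t' 0 ×ˢ Set.pi (Finset.range N : Set ℕ) fun i => t' (i + 1) := by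
    ext ⟨x, ξ⟩
    simp only [Set.mem_preimage, Set.mem_pi, Finset.mem_coe, Finset.mem_range, Set.mem_prod]
    constructor
    · exact fun h => ⟨h 0 (Nat.succ_pos _), fun i hi => h (i + 1) (Nat.succ_lt_succ hi)⟩
    · rintro ⟨h0, h⟩ (_ | i) hi
      · exact h0
      · exact h i (Nat.lt_of_succ_lt_succ hi)
  rw [hset, hprod, Measure.map_apply measurable_cons
      (MeasurableSet.pi (Set.to_countable _) fun i _ => ht'm i), hpre, Measure.prod_prod,
    outgrowthsLaw, Measure.infinitePi_pi _ (fun i _ => ht'm (i + 1)), Finset.prod_range_succ',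
    mul_comm]

theorem lintegral_outgrowthsLaw {a b : ℝ≥0} (ha : 0 < a) (hab : a + b = 1)
    {f : (ℕ → Outgrowth) → ℝ≥0∞} (hf : Measurable f) :
    ∫⁻ ξ, f ξ ∂outgrowthsLaw ha hab =
      ∑' x, (outgrowthMass a b x : ℝ≥0∞) * ∫⁻ ξ, f (cons x ξ) ∂outgrowthsLaw ha hab := by
  conv_lhs => rw [← map_cons_outgrowthsLaw ha hab]
  rw [lintegral_map hf measurable_cons, lintegral_prod (fun q => f (cons q.1 q.2))
      (hf.comp measurable_cons).aemeasurable,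
    lintegral_countable']
  refine tsum_congr fun x => ?_
  rw [PMF.toMeasure_apply_singleton _ _ (MeasurableSet.of_discrete), mul_comm]
  rfl

/-! ### Local convergence -/

/-- The vertices of the tree which has subtrees with vertex sets `u` and `v` above its root edge. -/
def graft (u v : List Bool → Bool) : List Bool → Bool
  | [] => true
  | false :: w => u w
  | true :: w => v w

/-- The vertices of the tree with outgrowth `x` at the first vertex and remaining part `u`. -/
def glue (u : List Bool → Bool) : Outgrowth → List Bool → Bool
  | none => graft u fun _ => false
  | some (false, t) => graft t.mem u
  | some (true, t) => graft u t.mem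

/-- The finite tree with outgrowth `x` at the first vertex and remaining part `r`. -/
def glueTree (r : FinTree) : Outgrowth → FinTree
  | none => .unary r
  | some (false, t) => .binary t r
  | some (true, t) => .binary r t

/-- The number of edges of an outgrowth. -/
def Outgrowth.size : Outgrowth → ℕ
  | none => 0
  | some (_, t) => t.size

theorem mem_glueTree (r : FinTree) (x : Outgrowth) : (glueTree r x).mem = glue r.mem x := by
  funext w
  rcases x with _ | ⟨_ | _, t⟩ <;> rcases w with _ | ⟨_ | _, w⟩ <;> rfl

theorem spineMem_cons (ξ : ℕ → Outgrowth) (x : Outgrowth) :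
    (fun w => spineMem w (cons x ξ)) = glue (fun w => spineMem w ξ) x := by
  funext w
  rcases x with _ | ⟨_ | _, t⟩ <;> rcases w with _ | ⟨_ | _, w⟩ <;> rfl

theorem glueTree_injOn : Set.InjOn (fun q : Outgrowth × FinTree => glueTree q.2 q.1)
    {q | q.1.size < q.2.size} := by
  rintro ⟨x, r⟩ h ⟨x', r'⟩ h' he
  rcases x with _ | ⟨_ | _, t⟩ <;> rcases x' with _ | ⟨_ | _, t'⟩ <;>
    simp only [glueTree, reduceCtorEq, FinTree.unary.injEq, FinTree.binary.injEq,
      Set.mem_ofPred_eq, Outgrowth.size] at he h h'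
  · rw [he]
  · rw [he.1, he.2]
  · rw [he.1, he.2] at h; omega
  · rw [he.1, he.2] at h; omega
  · rw [he.1, he.2]

theorem partitionFunction_add_mul_factorial_le {b : ℝ≥0} (hb : b ≤ 1) (j k : ℕ) :
    partitionFunction b (j + k) * (j + 1).factorial ≤
      partitionFunction b j * (j + k + 1).factorial := by
  induction k with
  | zero => simp
  | succ k ih =>
    rw [← add_assoc, partitionFunction_succ, Nat.factorial_succ (j + k + 1)]
    calc partitionFunction b (j + k) * ((j + k : ℕ) + 1 + b) * ((j + 1).factorial : ℝ≥0)
        = (partitionFunction b (j + k) * (j + 1).factorial) * ((j + k : ℕ) + 1 + b) := by ring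
      _ ≤ (partitionFunction b j * (j + k + 1).factorial) * ((j + k : ℕ) + 1 + 1) := by gcongr
      _ = _ := by push_cast; ring

/-- A factor that tends to one as the tree grows. -/
def sizeRatio (n k : ℕ) : ℝ≥0 :=
  if 2 * k < n + 1 then ((n - k : ℕ) + 1) / (n + 2) else 0

theorem tendsto_sizeRatio (k : ℕ) :
    Tendsto (fun n => (sizeRatio (n + k) k : ℝ≥0∞)) atTop (𝓝 1) := by
  rw [← ENNReal.coe_one, ENNReal.tendsto_coe, ← NNReal.tendsto_coe]
  have h : Tendsto (fun n : ℕ => ((n : ℝ) + 1) / (n + (k + 2))) atTop (𝓝 1) := by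
    have := tendsto_add_mul_div_add_mul_atTop_nhds (𝕜 := ℝ) 1 (k + 2) 1 one_ne_zero
    simpa [add_comm] using this
  refine h.congr' ?_
  filter_upwards [eventually_ge_atTop k] with n hn
  rw [sizeRatio, if_pos (by omega), Nat.add_sub_cancel]
  push_cast
  rw [add_assoc (n : ℝ)]

theorem mul_treeProb_le_binary {a b : ℝ≥0} (hab : a + b = 1) {n : ℕ} {t r : FinTree}
    (hr : r.size = n + 1) :
    ((n : ℝ≥0) + 1) / (n + t.size + 2) * (b / 2 * outgrowthProb a b t) * treeProb a b n r ≤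
      treeProb a b (n + t.size + 1) (.binary t r) := by
  have hb : b ≤ 1 := hab ▸ le_add_self
  rw [treeProb, if_pos hr, treeProb, if_pos (by simp only [FinTree.size]; omega), historyWeight,
    outgrowthProb, hr]
  set i := t.size
  have hZ := partitionFunction_add_mul_factorial_le hb n (i + 1)
  rw [← add_assoc] at hZ
  have hZ1 := partitionFunction_pos b n
  have hZ2 := partitionFunction_pos b (n + i + 1)
  have hβ : b / 2 * (a * (i + (n + 1)).choose (i + 1)) ≤ branchWeight a b i (n + 1) := by
    rw [branchWeight]
    gcongr
    refine le_trans ?_ le_add_self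
    gcongr
    exact le_self_add
  have hC : ((i + (n + 1)).choose (i + 1) : ℝ≥0) * ((i + 1).factorial * n.factorial) =
      (n + i + 1).factorial := by
    have := Nat.add_choose_mul_factorial_mul_factorial n (i + 1)
    rw [← Nat.choose_symm_add, Nat.choose_symm_add] at this
    rw [show i + (n + 1) = n + (i + 1) by ring, show n + i + 1 = n + (i + 1) by ring]
    rw [← this]
    push_cast
    ring
  have hratio : ((n : ℝ≥0) + 1) / (n + i + 2) * (1 / (i + 1).factorial) / partitionFunction b n ≤
      (i + (n + 1)).choose (i + 1) / partitionFunction b (n + i + 1) := by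
    rw [div_mul_div_comm, div_div, div_le_div_iff₀ (by positivity) hZ2]
    refine le_of_mul_le_mul_right ?_ (show (0 : ℝ≥0) < n.factorial by positivity)
    calc ((n : ℝ≥0) + 1) * 1 * partitionFunction b (n + i + 1) * n.factorial
        = partitionFunction b (n + i + 1) * (n + 1).factorial := by
          rw [Nat.factorial_succ]; push_cast; ring
      _ ≤ partitionFunction b n * (n + i + 1 + 1).factorial := hZ
      _ = partitionFunction b n * ((n + i + 2) * ((i + (n + 1)).choose (i + 1) *
            ((i + 1).factorial * n.factorial))) := by
          rw [hC, Nat.factorial_succ (n + i + 1)]; push_cast; ring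
      _ = _ := by ring
  calc _ = b / 2 * a * (historyWeight a b t * historyWeight a b r) *
        (((n : ℝ≥0) + 1) / (n + i + 2) * (1 / (i + 1).factorial) / partitionFunction b n) := by
        simp only [div_eq_mul_inv]; ring
    _ ≤ b / 2 * a * (historyWeight a b t * historyWeight a b r) *
        ((i + (n + 1)).choose (i + 1) / partitionFunction b (n + i + 1)) := by gcongr
    _ = b / 2 * (a * (i + (n + 1)).choose (i + 1)) * (historyWeight a b t * historyWeight a b r) /
        partitionFunction b (n + i + 1) := by simp only [div_eq_mul_inv]; ring
    _ ≤ _ := by gcongr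

theorem treeProb_binary_comm (a b : ℝ≥0) (n : ℕ) (l r : FinTree) :
    treeProb a b n (.binary l r) = treeProb a b n (.binary r l) := by
  have hs : (FinTree.binary l r).size = (FinTree.binary r l).size := by
    simp only [FinTree.size]; omega
  rw [treeProb, treeProb, hs, historyWeight, historyWeight, branchWeight_comm,
    mul_comm (historyWeight a b l)]

theorem mul_treeProb_le_unary {a b : ℝ≥0} (hab : a + b = 1) {n : ℕ} {r : FinTree}
    (hr : r.size = n + 1) : a * treeProb a b n r ≤ treeProb a b (n + 1) (.unary r) := by
  rw [treeProb, if_pos hr, treeProb, if_pos (by simp only [FinTree.size]; omega), historyWeight,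
    partitionFunction_succ, hr, ← mul_div_assoc,
    div_le_div_iff₀ (partitionFunction_pos _ _)
      (mul_pos (partitionFunction_pos _ _) (by positivity))]
  have ha : a ≤ 1 := hab ▸ le_self_add
  have h : a * (n + 1 + b) ≤ 2 * b + a * ((n + 1 : ℕ) : ℝ≥0) := by
    calc a * (n + 1 + b) = a * b + a * (n + 1) := by ring
      _ ≤ 2 * b + a * (n + 1) := by
        gcongr
        exact ha.trans one_le_two
      _ = _ := by push_cast; ring
  calc _ = a * (n + 1 + b) * (historyWeight a b r * partitionFunction b n) := by ring
    _ ≤ (2 * b + a * ((n + 1 : ℕ) : ℝ≥0)) * (historyWeight a b r * partitionFunction b n) := by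
        gcongr
    _ = _ := by ring

theorem mul_treeProb_le_glueTree {a b : ℝ≥0} (hab : a + b = 1) (n : ℕ) (x : Outgrowth)
    (r : FinTree) :
    sizeRatio n x.size * outgrowthMass a b x * treeProb a b (n - x.size) r ≤
      if x.size < r.size then treeProb a b (n + 1) (glueTree r x) else 0 := by
  by_cases hn : 2 * x.size < n + 1
  swap
  · simp [sizeRatio, hn]
  by_cases hr : r.size = n - x.size + 1
  swap
  · simp [treeProb, hr]
  rw [if_pos (by omega), sizeRatio, if_pos hn]
  rcases x with _ | ⟨c, t⟩
  · simp only [Outgrowth.size, Nat.sub_zero, outgrowthMass, glueTree] at hr ⊢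
    refine le_trans ?_ (mul_treeProb_le_unary hab hr)
    rw [mul_assoc]
    refine mul_le_of_le_one_left' (div_le_one_of_le₀ ?_ (by positivity))
    gcongr
    exact one_le_two
  · simp only [Outgrowth.size, outgrowthMass] at hn hr ⊢
    obtain ⟨m, rfl⟩ := Nat.exists_eq_add_of_le' (show t.size ≤ n by omega)
    rw [Nat.add_sub_cancel] at hr ⊢
    push_cast
    cases c with
    | false => exact mul_treeProb_le_binary hab hr
    | true => rw [glueTree, treeProb_binary_comm]; exact mul_treeProb_le_binary hab hr

/-- A lower bound for the law of the tree with one more edge. -/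
theorem tsum_outgrowth_le_tsum_treeProb {a b : ℝ≥0} (hab : a + b = 1) (n : ℕ)
    (f : FinTree → ℝ≥0∞) :
    ∑' x : Outgrowth, (sizeRatio n x.size : ℝ≥0∞) * ((outgrowthMass a b x : ℝ≥0∞) *
        ∑' r, (treeProb a b (n - x.size) r : ℝ≥0∞) * f (glueTree r x)) ≤
      ∑' t, (treeProb a b (n + 1) t : ℝ≥0∞) * f t := by
  set F : FinTree → ℝ≥0∞ := fun t => (treeProb a b (n + 1) t : ℝ≥0∞) * f t
  set S : Set (Outgrowth × FinTree) := {q | q.1.size < q.2.size}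
  calc _ ≤ ∑' x : Outgrowth, ∑' r : FinTree,
        S.indicator (fun q => F (glueTree q.2 q.1)) (x, r) := by
        simp only [← ENNReal.tsum_mul_left]
        gcongr with x r
        rw [← mul_assoc, ← mul_assoc, ← ENNReal.coe_mul, ← ENNReal.coe_mul]
        have h := mul_treeProb_le_glueTree hab n x r
        by_cases hs : x.size < r.size
        · rw [Set.indicator_of_mem (show (x, r) ∈ S from hs)]
          rw [if_pos hs] at h
          simp only [F]
          gcongr
        · rw [if_neg hs] at h
          rw [le_antisymm h zero_le]
          simp
    _ = ∑' q : S, F (glueTree q.1.2 q.1.1) := by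
        rw [← ENNReal.tsum_prod (f := fun x r => S.indicator _ (x, r))]
        exact (tsum_subtype S fun q => F (glueTree q.2 q.1)).symm
    _ ≤ ∑' t, F t :=
        ENNReal.tsum_comp_le_tsum_of_injective
          (f := fun q : S => glueTree q.1.2 q.1.1) (glueTree_injOn.injective) F

theorem measurable_glue (x : Outgrowth) : Measurable fun u : List Bool → Bool => glue u x := by
  refine measurable_pi_lambda _ fun w => ?_
  rcases x with _ | ⟨_ | _, t⟩ <;> rcases w with _ | ⟨_ | _, w⟩ <;>
    simp only [glue, graft] <;> first | exact measurable_const | exact measurable_pi_apply w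

theorem tsum_liminf_le {ι : Type*} [Countable ι] (f : ℕ → ι → ℝ≥0∞) :
    ∑' i, liminf (fun n => f n i) atTop ≤ liminf (fun n => ∑' i, f n i) atTop := by
  let _ : MeasurableSpace ι := ⊤
  have : DiscreteMeasurableSpace ι := ⟨fun _ => trivial⟩
  simp only [← lintegral_count]
  exact lintegral_liminf_le fun n => measurable_of_countable _

/-- Functions of a ball around the root: the limiting law is a lower bound. -/
theorem lintegral_spineMem_le_liminf {a b : ℝ≥0} (ha : 0 < a) (hab : a + b = 1) (R : ℕ)
    {g : (List Bool → Bool) → ℝ≥0∞} (hg : Measurable g)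
    (hR : ∀ u v : List Bool → Bool, (∀ w, w.length < R → u w = v w) → g u = g v) :
    ∫⁻ ξ, g (fun w => spineMem w ξ) ∂outgrowthsLaw ha hab ≤
      liminf (fun n => ∑' t, (treeProb a b n t : ℝ≥0∞) * g t.mem) atTop := by
  induction R generalizing g with
  | zero =>
    have hc (u) : g u = g fun _ => true := hR _ _ (by simp)
    simp only [hc, lintegral_const, measure_univ, mul_one, ENNReal.tsum_mul_right,
      tsum_treeProb hab, one_mul, liminf_const, le_refl]
  | succ R ih =>
    rw [lintegral_outgrowthsLaw ha hab (f := fun ξ => g fun w => spineMem w ξ)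
        (hg.comp (measurable_pi_lambda _ measurable_spineMem)),
      ← liminf_nat_add _ 1]
    refine le_trans ?_ (liminf_le_liminf (Eventually.of_forall fun n =>
      tsum_outgrowth_le_tsum_treeProb hab n fun t => g t.mem))
    refine le_trans (ENNReal.tsum_le_tsum fun x => ?_) (tsum_liminf_le _)
    rw [← liminf_nat_add _ x.size]
    simp only [Nat.add_sub_cancel, spineMem_cons, mem_glueTree]
    have hx := ih (g := fun u => g (glue u x)) (hg.comp (measurable_glue x)) fun u v huv => by
      refine hR _ _ fun w hw => ?_
      rcases x with _ | ⟨_ | _, t⟩ <;> rcases w with _ | ⟨_ | _, w⟩ <;>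
        simp only [glue, graft] <;> exact huv w (by simpa using hw)
    calc _ ≤ 1 * ((outgrowthMass a b x : ℝ≥0∞) *
          liminf (fun n => ∑' t, (treeProb a b n t : ℝ≥0∞) * g (glue t.mem x)) atTop) := by
          rw [one_mul]; gcongr
      _ = liminf (fun n => (sizeRatio (n + x.size) x.size : ℝ≥0∞)) atTop * liminf (fun n =>
          (outgrowthMass a b x : ℝ≥0∞) * ∑' t, (treeProb a b n t : ℝ≥0∞) * g (glue t.mem x))
            atTop := by
          rw [(tendsto_sizeRatio x.size).liminf_eq,
            ENNReal.liminf_const_mul_of_ne_top ENNReal.coe_ne_top]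
      _ ≤ _ := ENNReal.le_liminf_mul


/-- The law of the infinite tree. -/
def limitLaw {a b : ℝ≥0} (ha : 0 < a) (hab : a + b = 1) : ProbabilityMeasure PlaneTree :=
  ⟨(outgrowthsLaw ha hab).map spineTree,
    Measure.isProbabilityMeasure_map measurable_spineTree.aemeasurable⟩

theorem limitLaw_apply {a b : ℝ≥0} (ha : 0 < a) (hab : a + b = 1) (s : Set PlaneTree) :
    (limitLaw ha hab : Measure PlaneTree) s = outgrowthsLaw ha hab (spineTree ⁻¹' s) :=
  measurableEmbedding_spineTree.map_apply _ _

theorem law_apply {α : unitInterval} {a b : ℝ≥0} (hα : (α : ℝ) = a) (hab : a + b = 1) (n : ℕ)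
    {G : Set PlaneTree} (hG : MeasurableSet G) :
    (law α n : Measure PlaneTree) G =
      ∑' t, (treeProb a b (n + 1) t : ℝ≥0∞) * G.indicator 1 t.toPlaneTree := by
  change ((finLaw α n).map FinTree.toPlaneTree).toMeasure G = _
  rw [PMF.toMeasure_map_apply _ _ _ (measurable_of_countable _) hG,
    PMF.toMeasure_apply _ (MeasurableSet.of_discrete)]
  refine tsum_congr fun t => ?_
  by_cases ht : t.toPlaneTree ∈ G
  · rw [Set.indicator_of_mem (show t ∈ FinTree.toPlaneTree ⁻¹' G from ht),
      Set.indicator_of_mem ht, finLaw_apply hα hab]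
    simp
  · rw [Set.indicator_of_notMem (show t ∉ FinTree.toPlaneTree ⁻¹' G from ht),
      Set.indicator_of_notMem ht, mul_zero]

/-- The vertex sets `u` such that all trees which have the same ball of radius `R` belong to `G`. -/
def ballInterior (G : Set PlaneTree) (R : ℕ) : Set (List Bool → Bool) :=
  {u | ∀ T : PlaneTree, (∀ w : List Bool, w.length < R → T.1 w = u w) → T ∈ G}

theorem mem_ballInterior_congr {G : Set PlaneTree} {R : ℕ} {u v : List Bool → Bool}
    (h : ∀ w : List Bool, w.length < R → u w = v w) :
    u ∈ ballInterior G R ↔ v ∈ ballInterior G R := by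
  refine forall_congr' fun T => imp_congr_left (forall₂_congr fun w hw => ?_)
  rw [h w hw]

theorem isOpen_ballInterior (G : Set PlaneTree) (R : ℕ) : IsOpen (ballInterior G R) := by
  refine isOpen_iff_forall_mem_open.2 fun u hu =>
    ⟨Set.pi {w | w.length < R} fun w => {u w}, fun v hv => ?_,
      isOpen_set_pi (List.finite_length_lt Bool R) fun w _ => isOpen_discrete _, by simp⟩
  exact (mem_ballInterior_congr fun w hw => by simpa using hv w hw).2 hu

theorem ballInterior_mono (G : Set PlaneTree) : Monotone (ballInterior G) :=
  fun _ _ h _ hu T hT => hu T fun w hw => hT w (hw.trans_le h)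

theorem exists_mem_ballInterior {G : Set PlaneTree} (hG : IsOpen G) {T : PlaneTree} (hT : T ∈ G) :
    ∃ R, T.1 ∈ ballInterior G R := by
  obtain ⟨U, hU, rfl⟩ := isOpen_induced_iff.1 hG
  obtain ⟨I, u, hu, hI⟩ := isOpen_pi_iff.1 hU T.1 hT
  refine ⟨I.sup List.length + 1, fun T' hT' => hI fun w hw => ?_⟩
  rw [hT' w (Nat.lt_succ_of_le (Finset.le_sup (f := List.length) hw))]
  exact (hu w hw).2

theorem tendsto_law {α : unitInterval} {a b : ℝ≥0} (hα : (α : ℝ) = a) (ha : 0 < a)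
    (hab : a + b = 1) : Tendsto (law α) atTop (𝓝 (limitLaw ha hab)) := by
  refine tendsto_of_forall_isOpen_le_liminf_nat' fun G hG => ?_
  have hunion : spineTree ⁻¹' G = ⋃ R, {ξ | (spineTree ξ).1 ∈ ballInterior G R} := by
    ext ξ
    simp only [Set.mem_preimage, Set.mem_iUnion]
    exact ⟨fun h => exists_mem_ballInterior hG h, fun ⟨R, h⟩ => h _ fun _ _ => rfl⟩
  rw [limitLaw_apply, hunion, Monotone.measure_iUnion]
  swap
  · exact fun R S h ξ hξ => ballInterior_mono G h hξ
  refine iSup_le fun R => ?_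
  have hmeas : MeasurableSet (ballInterior G R) := (isOpen_ballInterior G R).measurableSet
  have h := lintegral_spineMem_le_liminf ha hab R (g := (ballInterior G R).indicator 1)
    (measurable_one.indicator hmeas) fun u v huv => by
      have := mem_ballInterior_congr (G := G) huv
      by_cases hv : v ∈ ballInterior G R
      · simp [hv, this.2 hv]
      · simp [hv, mt this.1 hv]
  have hset : MeasurableSet {ξ | (spineTree ξ).1 ∈ ballInterior G R} :=
    (measurable_subtype_coe.comp measurable_spineTree) hmeas
  rw [← lintegral_indicator_one hset]
  refine h.trans ?_
  rw [← liminf_nat_add _ 1]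
  refine liminf_le_liminf (Eventually.of_forall fun n => ?_)
  rw [law_apply hα hab n hG.measurableSet]
  refine ENNReal.tsum_le_tsum fun t => mul_le_mul_right ?_ _
  by_cases ht : t.mem ∈ ballInterior G R
  · rw [Set.indicator_of_mem ht, Set.indicator_of_mem (ht t.toPlaneTree fun _ _ => rfl)]
    rfl
  · rw [Set.indicator_of_notMem ht]
    exact zero_le

theorem outgrowthLaw_height {a b : ℝ≥0} (ha : 0 < a) (hab : a + b = 1) (n : ℕ) :
    (outgrowthLaw ha hab).toMeasure {x | ∃ c t, x = some (c, t) ∧ n ≤ t.height} =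
      b * heightTail a b n := by
  rw [PMF.toMeasure_apply _ (MeasurableSet.of_discrete), tsum_outgrowth]
  have h (c : Bool) : ∑' t, Set.indicator {x | ∃ c t, x = some (c, t) ∧ n ≤ t.height}
      (outgrowthLaw ha hab) (some (c, t)) = (b / 2 : ℝ≥0) * heightTail a b n := by
    rw [heightTail, ← ENNReal.tsum_mul_left]
    refine tsum_congr fun t => ?_
    by_cases ht : n ≤ t.height
    · rw [Set.indicator_of_mem (by exact ⟨c, t, rfl, ht⟩), if_pos ht, ← ENNReal.coe_mul]
      rfl
    · rw [if_neg ht, mul_zero, Set.indicator_of_notMem]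
      rintro ⟨c', t', h, ht'⟩
      simp only [Option.some.injEq, Prod.mk.injEq] at h
      exact ht (h.2 ▸ ht')
  rw [h, h, Set.indicator_of_notMem (by simp), zero_add, ← add_mul, ← ENNReal.coe_add, add_halves]

theorem limitLaw_generationSize_le {a b : ℝ≥0} (ha : 0 < a) (hab : a + b = 1) (hba : b ≤ a)
    (i n : ℕ) :
    (limitLaw ha hab : Measure PlaneTree).real {T | 0 < generationSize (i + 1) (n + 1) T} ≤
      2 / (n + 4) := by
  refine le_trans ?_ (mul_heightTail_le ha hab hba n)
  have hfin : heightTail a b n ≠ ⊤ :=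
    ((heightTail_le_one ha hab n).trans_lt ENNReal.one_lt_top).ne
  rw [measureReal_def, limitLaw_apply, ← ENNReal.coe_toReal, ← ENNReal.toReal_mul,
    ← outgrowthLaw_height ha hab]
  refine ENNReal.toReal_mono (measure_ne_top _ _) ?_
  rw [← (measurePreserving_eval_infinitePi (fun _ : ℕ => (outgrowthLaw ha hab).toMeasure)
    i).measure_preimage (MeasurableSet.of_discrete).nullMeasurableSet]
  exact measure_mono fun ξ hξ => exists_outgrowth_of_generationSize_pos hξ

end AGModel

end

theorem lemma4 (α : unitInterval) (hα : 1 / 2 ≤ (α : ℝ)) :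
    ∃ ν : ProbabilityMeasure AGModel.PlaneTree,
      Tendsto (AGModel.law α) atTop (𝓝 ν) ∧
      (∀ᵐ T ∂(ν : Measure AGModel.PlaneTree), AGModel.HasUniqueSpine T) ∧
      ∃ ε : ℕ → ℝ, Tendsto ε atTop (𝓝 0) ∧
        ∀ i n : ℕ, 1 ≤ i → 1 ≤ n →
          (ν : Measure AGModel.PlaneTree).real {T | 0 < AGModel.generationSize i n T} ≤
            2 / (n : ℝ) * (1 + ε n) := by
  set a : NNReal := ⟨α, α.2.1⟩
  set b : NNReal := ⟨1 - α, sub_nonneg.2 α.2.2⟩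
  have hab : a + b = 1 := NNReal.eq (add_sub_cancel (α : ℝ) 1)
  have ha : 0 < a := show (0 : ℝ) < α by linarith
  have hba : b ≤ a := show 1 - (α : ℝ) ≤ α by linarith
  refine ⟨AGModel.limitLaw ha hab, AGModel.tendsto_law rfl ha hab, ?_, fun _ => 0,
    tendsto_const_nhds, fun i n hi hn => ?_⟩
  · exact (AGModel.measurableEmbedding_spineTree.ae_map_iff).2
      (Eventually.of_forall AGModel.hasUniqueSpine_spineTree)
  · obtain ⟨i, rfl⟩ := Nat.exists_eq_add_of_le' hi
    obtain ⟨n, rfl⟩ := Nat.exists_eq_add_of_le' hn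
    refine (AGModel.limitLaw_generationSize_le ha hab hba i n).trans ?_
    rw [add_zero, mul_one]
    push_cast
    gcongr
    norm_num
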